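/- Let $n \ge 1$ be an integer, let $a \in (0,1)$, let $z_1,\dots,z_{n-1} \in \mathbb{C}$ satisfy $|z_k| \le 1$ for all $k$, and let $$p(z) = (z-a)\prod_{k=1}^{n-1}(z-z_k),$$ a polynomial of degree $n$. Suppose that every critical point of $p$ (that is, every zero $\zeta \in \mathbb{C}$ of $p'$) satisfies $|a-\zeta| \ge 1$. Let $\lambda$ be a real number such that $$1-(1-|p(0)|)^{1/n} \le \lambda \le \sin\left(\frac{\pi}{n}\right) \quad\text{and}\quad \lambda < a.$$ Then $p$ has a critical point $\zeta_0$ such that $$\operatorname{Re} \zeta_0 \ge \frac{1}{2}\left(a - \frac{\lambda(\lambda+2)}{a}\right).$$ -/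

import Mathlib

open Polynomial

/-! All zeros of `p'` are at distance at least `1` from `a`, so `|p'(x)| ≥ n (1 - |x - a|) ^ (n -
1)` on the unit disc about `a`. Lifting the segment from `0` to `p(0)` through `p`, starting at `a`,
therefore ends at a point `w` with `p(w) = p(0)` and `|w - a| ≤ lam < a`, so `w ≠ 0`. By Grace's
theorem some critical point `ζ` satisfies `|ζ - w| ≤ |ζ|`, hence `|ζ - a| ≤ |ζ| + lam`. Since `|ζ| ≤
1` by Gauss–Lucas, squaring bounds `Re ζ` from below. -/

/-! ### Laguerre's and Grace's theorems -/

theorem Convex.multiset_sum_div_mem {K : Set ℂ} (hK : Convex ℝ K) (h0 : (0 : ℂ) ∈ K)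
    (s : Multiset ℂ) (hs : ∀ t ∈ s, t ∈ K) (m : ℕ) (hm : s.card ≤ m) :
    s.sum / (m : ℂ) ∈ K := by
  induction s using Multiset.induction_on generalizing m with
  | empty => simpa using h0
  | cons a s ih =>
    obtain ⟨k, rfl⟩ : ∃ k, m = k + 1 := ⟨m - 1, by simp at hm; omega⟩
    have hsk : s.card ≤ k := by simpa using hm
    have h1 := ih (fun t ht => hs t (Multiset.mem_cons_of_mem ht)) k hsk
    have h2 := hs a (Multiset.mem_cons_self a s)
    have hk : (0 : ℝ) < (k : ℝ) + 1 := by positivity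
    have h3 := hK h2 h1 (a := 1 / ((k : ℝ) + 1)) (b := (k : ℝ) / ((k : ℝ) + 1))
      (by positivity) (by positivity) (by field_simp; ring)
    convert h3 using 1
    have hk' : (k : ℂ) + 1 ≠ 0 := by exact_mod_cast hk.ne'
    rcases Nat.eq_zero_or_pos k with rfl | hk0
    · have : s = 0 := by simpa using hsk
      subst this
      simp
    · have hkc : (k : ℂ) ≠ 0 := by exact_mod_cast hk0.ne'
      simp only [Multiset.sum_cons, Complex.real_smul]
      push_cast
      field_simp

/-- The polynomial `ζ ↦ L ((X - ζ) ^ m)` attached to a linear functional `L`, with its derivative. -/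
theorem exists_polynomial_eval_eq_functional_pow (m : ℕ) (L : ℂ[X] →ₗ[ℂ] ℂ) :
    ∃ F : ℂ[X], F.natDegree ≤ m ∧ (∀ ζ, F.eval ζ = L ((X - C ζ) ^ m)) ∧
      ∀ ζ, F.derivative.eval ζ = -(m * L ((X - C ζ) ^ (m - 1))) := by
  induction m generalizing L with
  | zero => exact ⟨C (L 1), by simp, by simp, by simp⟩
  | succ m ih =>
    obtain ⟨F, hF, hFe, hFd⟩ := ih (L ∘ₗ LinearMap.mulLeft ℂ X)
    obtain ⟨G, hG, hGe, hGd⟩ := ih L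
    have key : ∀ (ζ : ℂ) (q : ℂ[X]), L (X * q) - ζ * L q = L ((X - C ζ) * q) := fun ζ q => by
      rw [sub_mul, map_sub, ← smul_eq_C_mul, map_smul, smul_eq_mul]
    refine ⟨F - X * G, ?_, fun ζ => ?_, fun ζ => ?_⟩
    · refine (natDegree_sub_le _ _).trans (max_le (hF.trans m.le_succ) ?_)
      exact natDegree_mul_le.trans (by simp; omega)
    · simp [hFe, hGe, key, pow_succ']
    · have h := key ζ ((X - C ζ) ^ (m - 1))
      have h' : (m : ℂ) * L ((X - C ζ) * (X - C ζ) ^ (m - 1)) = m * L ((X - C ζ) ^ m) := by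
        rcases m with _ | m
        · simp
        · simp [pow_succ']
      simp only [derivative_sub, derivative_mul, derivative_X, eval_sub, eval_add, eval_mul, hFd,
        hGd, hGe, LinearMap.comp_apply, LinearMap.mulLeft_apply, eval_X, one_mul,
        Nat.add_sub_cancel]
      push_cast
      linear_combination (-(m : ℂ)) * h - h'

/-- Laguerre's theorem on polar derivatives, for the polynomial `ζ ↦ L ((X - ζ) ^ (m + 1))`. -/
theorem functional_mul_pow_ne_zero {D : Set ℂ}
    (hD : ∀ ζ ∈ D, Convex ℝ {t : ℂ | t = 0 ∨ ζ - t⁻¹ ∉ D}) (L : ℂ[X] →ₗ[ℂ] ℂ) (m : ℕ)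
    (h : ∀ ζ ∈ D, L ((X - C ζ) ^ (m + 1)) ≠ 0) {ξ ζ : ℂ} (hξ : ξ ∈ D) (hζ : ζ ∈ D) :
    L ((X - C ξ) * (X - C ζ) ^ m) ≠ 0 := by
  intro h0
  obtain ⟨F, hF, hFe, hFd⟩ := exists_polynomial_eval_eq_functional_pow (m + 1) L
  have hFζ : F.eval ζ ≠ 0 := hFe ζ ▸ h ζ hζ
  have hne : ζ - ξ ≠ 0 := fun he => h ζ hζ (by
    rw [sub_eq_zero] at he; rwa [← he, ← pow_succ'] at h0)
  have hm : ((m : ℂ) + 1) ≠ 0 := by exact_mod_cast m.succ_ne_zero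
  have hpolar : (ζ - ξ) * F.derivative.eval ζ = (m + 1) * F.eval ζ := by
    have : (X - C ξ) * (X - C ζ) ^ m
        = (X - C ζ) ^ (m + 1) + (ζ - ξ) • (X - C ζ) ^ m := by
      rw [smul_eq_C_mul, C_sub]; ring
    rw [this, map_add, map_smul, smul_eq_mul, ← hFe] at h0
    rw [hFd]
    push_cast
    linear_combination (-((m : ℂ) + 1)) * h0
  have hlog := (IsAlgClosed.splits F).eval_derivative_div_eval_of_ne_zero hFζ
  -- The map `r ↦ 1 / (ζ - r)` carries the complement of `D` into the convex set of `hD`, with `∞`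
  -- going to `0`. If `F` has degree below `m + 1`, the missing roots count as `∞`.
  have hmem := (hD ζ hζ).multiset_sum_div_mem (Or.inl rfl) (F.roots.map fun r => 1 / (ζ - r))
    (by
      intro t ht
      obtain ⟨r, hr, rfl⟩ := Multiset.mem_map.1 ht
      refine Or.inr fun hrD => h _ hrD ?_
      rw [← hFe, one_div, inv_inv, sub_sub_cancel]
      exact isRoot_of_mem_roots hr) (m + 1)
    (by rw [Multiset.card_map]; exact F.card_roots'.trans hF)
  have hval : (F.roots.map fun r => 1 / (ζ - r)).sum / ((m + 1 : ℕ) : ℂ) = (ζ - ξ)⁻¹ := by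
    rw [← hlog]
    push_cast
    field_simp
    linear_combination hpolar
  rw [hval] at hmem
  rcases hmem with h1 | h1
  · exact inv_ne_zero hne h1
  · rw [inv_inv, sub_sub_cancel] at h1
    exact h1 hξ

/-- Grace's theorem: a linear functional which does not vanish on the powers `(X - ζ) ^ m`, `ζ ∈ D`,
does not vanish on a product of `m` factors `X - ζ`, `ζ ∈ D`. -/
theorem functional_multiset_prod_ne_zero {D : Set ℂ} (hD' : D.Nonempty)
    (hD : ∀ ζ ∈ D, Convex ℝ {t : ℂ | t = 0 ∨ ζ - t⁻¹ ∉ D}) (L : ℂ[X] →ₗ[ℂ] ℂ)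
    (s : Multiset ℂ) (hs : ∀ ζ ∈ s, ζ ∈ D) (h : ∀ ζ ∈ D, L ((X - C ζ) ^ s.card) ≠ 0) :
    L (s.map fun ζ => X - C ζ).prod ≠ 0 := by
  induction s using Multiset.induction_on generalizing L with
  | empty => obtain ⟨ζ, hζ⟩ := hD'; simpa using h ζ hζ
  | cons ξ s ih =>
    rw [Multiset.map_cons, Multiset.prod_cons]
    refine ih (L ∘ₗ LinearMap.mulLeft ℂ (X - C ξ))
      (fun ζ hζ => hs ζ (Multiset.mem_cons_of_mem hζ)) fun ζ hζ => ?_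
    rw [Multiset.card_cons] at h
    exact functional_mul_pow_ne_zero hD L _ h (hs ξ (Multiset.mem_cons_self ξ s)) hζ

/-! ### A critical point from two equal values -/

/-- `L` is integration from `0` to `w`; thus `p(w) = p(0)` says that `L` kills `p'`. -/
theorem exists_functional_derivative_eq (w : ℂ) :
    ∃ L : ℂ[X] →ₗ[ℂ] ℂ, ∀ q : ℂ[X], L q.derivative = q.eval w - q.eval 0 := by
  refine ⟨lsum fun k => (w ^ (k + 1) / (k + 1)) • LinearMap.id, fun q => ?_⟩
  induction q using Polynomial.induction_on' with
  | add p q hp hq => rw [derivative_add, map_add, hp, hq, eval_add, eval_add]; ring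
  | monomial k c =>
    rcases k with _ | k
    · simp
    · have : (k : ℂ) + 1 ≠ 0 := by exact_mod_cast k.succ_ne_zero
      rw [derivative_monomial, lsum_apply, sum_monomial_index _ _ (by simp)]
      simp
      field_simp

/-- Multiplying by `‖t‖ ^ 2` turns the condition into a quadratic inequality whose leading
coefficient is positive because `ζ` lies in the half-plane: a disc. -/
theorem convex_setOf_inv_notMem_halfPlane (w ζ : ℂ) (hζ : ‖ζ‖ < ‖ζ - w‖) :
    Convex ℝ {t : ℂ | t = 0 ∨ ζ - t⁻¹ ∉ {z : ℂ | ‖z‖ < ‖z - w‖}} := by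
  have hset : {t : ℂ | t = 0 ∨ ζ - t⁻¹ ∉ {z : ℂ | ‖z‖ < ‖z - w‖}} =
      {t : ℂ | t ∈ Set.univ ∧
        (‖ζ - w‖ ^ 2 - ‖ζ‖ ^ 2) * ‖t‖ ^ 2 + (2 * w.re * t.re - 2 * w.im * t.im) ≤ 0} := by
    ext t
    by_cases ht : t = 0
    · simp [ht]
    have ht' : 0 < ‖t‖ := norm_pos_iff.2 ht
    have e1 : ‖ζ - t⁻¹‖ * ‖t‖ = ‖ζ * t - 1‖ := by
      rw [← norm_mul, sub_mul, inv_mul_cancel₀ ht]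
    have e2 : ‖ζ - t⁻¹ - w‖ * ‖t‖ = ‖(ζ - w) * t - 1‖ := by
      rw [← norm_mul]; congr 1; field_simp; ring
    simp only [Set.mem_ofPred_eq, ht, false_or, not_lt, Set.mem_univ, true_and]
    rw [← mul_le_mul_iff_left₀ ht', e1, e2, ← sq_le_sq₀ (norm_nonneg _) (norm_nonneg _)]
    simp only [Complex.sq_norm, Complex.normSq_apply, Complex.sub_re, Complex.sub_im,
      Complex.mul_re, Complex.mul_im, Complex.one_re, Complex.one_im]
    constructor <;> intro h <;> nlinarith
  rw [hset]
  apply ConvexOn.convex_le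
  have hc : 0 ≤ ‖ζ - w‖ ^ 2 - ‖ζ‖ ^ 2 := by nlinarith [norm_nonneg ζ]
  refine ConvexOn.add ?_ ?_
  · exact ((convexOn_univ_norm).pow (fun _ _ => norm_nonneg _) 2).smul hc
  · refine ⟨convex_univ, fun x _ y _ a b _ _ _ => le_of_eq ?_⟩
    simp
    ring

/-- If `p` takes the same value at `0` and at `w`, then `p` has a critical point at least as close
to `w` as to `0`. -/
theorem exists_isRoot_derivative_norm_sub_le {p : ℂ[X]} (hp : p.derivative ≠ 0) {w : ℂ}
    (hw : w ≠ 0) (h : p.eval w = p.eval 0) :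
    ∃ ζ, p.derivative.IsRoot ζ ∧ ‖ζ - w‖ ≤ ‖ζ‖ := by
  by_contra! hcon
  obtain ⟨L, hL⟩ := exists_functional_derivative_eq w
  have hne := functional_multiset_prod_ne_zero (D := {z : ℂ | ‖z‖ < ‖z - w‖}) ⟨0, by simpa using hw⟩
    (fun ζ hζ => convex_setOf_inv_notMem_halfPlane w ζ hζ) L p.derivative.roots
    (fun ζ hζ => hcon ζ (isRoot_of_mem_roots hζ)) fun ζ hζ h0 => by
      set m := p.derivative.roots.card
      have h1 := hL ((X - C ζ) ^ (m + 1))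
      have h2 : derivative ((X - C ζ) ^ (m + 1)) = ((m : ℂ) + 1) • (X - C ζ) ^ m := by
        rw [derivative_X_sub_C_pow, smul_eq_C_mul]; simp
      rw [h2, map_smul, h0, smul_zero] at h1
      simp only [eval_pow, eval_sub, eval_X, eval_C, zero_sub] at h1
      -- Equality of `(w - ζ) ^ (m + 1)` and `(-ζ) ^ (m + 1)` would put `ζ` on the bisector of `0`
      -- and `w`.
      have h3 := congrArg norm (sub_eq_zero.1 h1.symm)
      rw [norm_pow, norm_pow, norm_neg, norm_sub_rev] at h3
      have hζ' : ‖ζ‖ < ‖ζ - w‖ := hζ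
      exact (pow_lt_pow_left₀ hζ' (norm_nonneg _) m.succ_ne_zero).ne' h3
  apply hne
  have h1 := hL p
  rw [h, sub_self, (IsAlgClosed.splits p.derivative).eq_prod_roots, ← smul_eq_C_mul, map_smul,
    smul_eq_mul] at h1
  exact (mul_eq_zero.1 h1).resolve_left (leadingCoeff_ne_zero.2 hp)

/-! ### Lifting a segment through `p` -/

theorem leadingCoeff_mul_pow_le_norm_eval (q : ℂ[X]) {c z : ℂ}
    (hq : ∀ ζ, q.IsRoot ζ → 1 ≤ ‖c - ζ‖) (hz : ‖z - c‖ ≤ 1) :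
    ‖q.leadingCoeff‖ * (1 - ‖z - c‖) ^ q.natDegree ≤ ‖q.eval z‖ := by
  have key : ∀ s : Multiset ℂ, (∀ ζ ∈ s, 1 ≤ ‖c - ζ‖) →
      (1 - ‖z - c‖) ^ s.card ≤ ‖(s.map fun ζ => z - ζ).prod‖ := by
    intro s
    induction s using Multiset.induction_on with
    | empty => simp
    | cons ξ s ih =>
      intro hs
      rw [Multiset.map_cons, Multiset.prod_cons, norm_mul, Multiset.card_cons, pow_succ']
      have h1 := hs ξ (Multiset.mem_cons_self ξ s)
      have h2 : ‖c - ξ‖ ≤ ‖z - c‖ + ‖z - ξ‖ := by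
        rw [norm_sub_rev z c]
        simpa using norm_add_le (c - z) (z - ξ)
      exact mul_le_mul (by linarith) (ih fun ζ hζ => hs ζ (Multiset.mem_cons_of_mem hζ))
        (pow_nonneg (by linarith) _) (norm_nonneg _)
  have hsp := IsAlgClosed.splits q
  rw [hsp.eval_eq_prod_roots, norm_mul, hsp.natDegree_eq_card_roots]
  gcongr
  exact key _ fun ζ hζ => hq ζ (isRoot_of_mem_roots hζ)

theorem pow_sub_mul_le_sub_pow {u δ : ℝ} (hu : 0 < u) (hδ : δ ≤ u) (n : ℕ) :
    u ^ n - n * u ^ (n - 1) * δ ≤ (u - δ) ^ n := by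
  rcases n with _ | n
  · simp
  have h := one_add_mul_le_pow (a := -(δ / u)) (by
    have : δ / u ≤ 1 := (div_le_one hu).2 hδ
    linarith) (n + 1)
  have h2 := mul_le_mul_of_nonneg_left h (pow_pos hu (n + 1)).le
  rw [← mul_pow] at h2
  have e1 : u * (1 + -(δ / u)) = u - δ := by field_simp; ring
  have e2 : u ^ (n + 1) * (1 + ((n + 1 : ℕ) : ℝ) * -(δ / u)) =
      u ^ (n + 1) - ((n + 1 : ℕ) : ℝ) * u ^ n * δ := by field_simp; ring
  rw [e1, e2] at h2
  exact h2

open Filter Topology in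
/-- Lifting of a small step along the segment `t ↦ t * w` through `p`, with control of the distance
to the base point `c`. -/
theorem eventually_exists_lift {p : ℂ[X]} {c w : ℂ} {n : ℕ} {K s : ℝ}
    (hder : ∀ z, ‖z - c‖ ≤ 1 → n * (1 - ‖z - c‖) ^ (n - 1) ≤ ‖p.derivative.eval z‖) (hn : n ≠ 0)
    (hwK : ‖w‖ < K) {z : ℂ} (hz : ‖z - c‖ < 1) (hpz : p.eval z = s * w)
    (hzK : 1 - (1 - ‖z - c‖) ^ n ≤ s * K) :
    ∀ᶠ t : ℝ in 𝓝[>] s, ∃ z, ‖z - c‖ ≤ 1 ∧ p.eval z = t * w ∧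
      1 - (1 - ‖z - c‖) ^ n ≤ t * K := by
  have hu : 0 < 1 - ‖z - c‖ := by linarith
  have hd : 0 < ‖p.derivative.eval z‖ :=
    lt_of_lt_of_le (by positivity) (hder z hz.le)
  have hd0 : p.derivative.eval z ≠ 0 := norm_pos_iff.1 hd
  have hs := p.hasStrictDerivAt z
  set g := hs.localInverse (fun x => p.eval x) _ z hd0
  have hline : HasDerivAt (fun t : ℝ => (t : ℂ) * w) w s := by
    simpa using (Complex.ofRealCLM.hasDerivAt (x := s)).mul_const w
  have hinv : ∀ᶠ t : ℝ in 𝓝 s, p.eval (g (t * w)) = t * w := by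
    have h := hs.eventually_right_inverse hd0
    rw [hpz] at h
    exact hline.continuousAt.eventually h
  have hg : HasDerivAt (fun t : ℝ => g (t * w)) ((p.derivative.eval z)⁻¹ * w) s := by
    have h := (hs.to_localInverse hd0).hasDerivAt
    rw [hpz] at h
    exact h.comp s hline
  have hgs : g (s * w) = z := by
    rw [← hpz]
    exact (hs.hasStrictFDerivAt_equiv hd0).localInverse_apply_image
  -- The strict inequality `‖w‖ < K` absorbs the first-order error of the local inverse.
  have hslope := hg.hasDerivWithinAt (s := Set.Ioi s) |>.limsup_norm_slope_le
    (r := K / ‖p.derivative.eval z‖) (by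
      rw [norm_mul, norm_inv, inv_mul_eq_div]; gcongr)
  have hsmall : ∀ᶠ t : ℝ in 𝓝[>] s, (t - s) * (K / ‖p.derivative.eval z‖) < 1 - ‖z - c‖ := by
    have : ContinuousAt (fun t : ℝ => (t - s) * (K / ‖p.derivative.eval z‖)) s := by fun_prop
    exact (this.eventually_lt_const (by simpa using hu)).filter_mono nhdsWithin_le_nhds
  filter_upwards [hslope, hsmall, hinv.filter_mono nhdsWithin_le_nhds, self_mem_nhdsWithin]
    with t h1 h2 h3 h4
  have hts : 0 < t - s := sub_pos.2 h4
  rw [hgs, Real.norm_of_nonneg hts.le, inv_mul_lt_iff₀ hts] at h1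
  set δ := (t - s) * (K / ‖p.derivative.eval z‖)
  have h5 : ‖g (t * w) - c‖ ≤ ‖z - c‖ + δ := by
    have := norm_add_le (g (t * w) - z) (z - c)
    rw [sub_add_sub_cancel] at this
    linarith
  refine ⟨g (t * w), by linarith, h3, ?_⟩
  have h6 := pow_sub_mul_le_sub_pow hu h2.le n
  have h7 : (1 - ‖z - c‖ - δ) ^ n ≤ (1 - ‖g (t * w) - c‖) ^ n :=
    pow_le_pow_left₀ (by linarith) (by linarith) n
  have hδ : 0 ≤ δ := by
    have := (norm_nonneg w).trans hwK.le
    positivity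
  have h8 : n * (1 - ‖z - c‖) ^ (n - 1) * δ ≤ (t - s) * K := by
    refine (mul_le_mul_of_nonneg_right (hder z hz.le) hδ).trans_eq ?_
    simp only [δ]
    field_simp
  linarith

theorem exists_eval_eq_of_norm_lt {p : ℂ[X]} {c w : ℂ} {n : ℕ} {K : ℝ}
    (hder : ∀ z, ‖z - c‖ ≤ 1 → n * (1 - ‖z - c‖) ^ (n - 1) ≤ ‖p.derivative.eval z‖) (hn : n ≠ 0)
    (hc : p.eval c = 0) (hwK : ‖w‖ < K) (hK : K < 1) :
    ∃ z, ‖z - c‖ ≤ 1 ∧ p.eval z = w ∧ 1 - (1 - ‖z - c‖) ^ n ≤ K := by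
  set S : Set ℝ := {t | ∃ z, ‖z - c‖ ≤ 1 ∧ p.eval z = t * w ∧ 1 - (1 - ‖z - c‖) ^ n ≤ t * K}
  have hclosed : IsClosed (S ∩ Set.Icc 0 1) := by
    have hcl : IsClosed {x : ℂ × ℝ | p.eval x.1 = x.2 * w ∧ 1 - (1 - ‖x.1 - c‖) ^ n ≤ x.2 * K} := by
      refine IsClosed.and ?_ ?_
      · exact isClosed_eq (by fun_prop) (by fun_prop)
      · exact isClosed_le (by fun_prop) (by fun_prop)
    have hcomp := ((isCompact_closedBall c 1).prod (isCompact_Icc (a := (0 : ℝ)) (b := 1))).inter_right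
      hcl |>.image continuous_snd
    convert hcomp.isClosed using 1
    ext t
    simp only [S, Set.mem_inter_iff, Set.mem_ofPred_eq, Set.mem_image, Set.mem_prod,
      Metric.mem_closedBall, dist_eq_norm, Prod.exists, exists_eq_right]
    constructor
    · rintro ⟨⟨z, h1, h2⟩, h3⟩
      exact ⟨z, ⟨h1, h3⟩, h2⟩
    · rintro ⟨z, ⟨h1, h3⟩, h2⟩
      exact ⟨⟨z, h1, h2⟩, h3⟩
  have h0 : (0 : ℝ) ∈ S := ⟨c, by simp, by simp [hc], by simp⟩
  -- Continuous induction on `t`: `K < 1` keeps the lift off the boundary of the disc, where `p'`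
  -- could vanish.
  have h1 := hclosed.Icc_subset_of_forall_mem_nhdsWithin h0 (by
    rintro s ⟨⟨z, hz, hpz, hzK⟩, hs⟩
    refine eventually_exists_lift hder hn hwK (lt_of_le_of_ne hz fun h => ?_) hpz hzK
    rw [h, sub_self, zero_pow hn] at hzK
    have hK0 : 0 ≤ K := (norm_nonneg w).trans hwK.le
    nlinarith [hs.1, hs.2]) (Set.right_mem_Icc.2 zero_le_one)
  simpa [S] using h1

/-- Every value `w` with `‖w‖ < 1` is attained by `p` close to its zero `c`, when `p'` is bounded
below near `c`. -/
theorem exists_eval_eq_of_norm_lt_one {p : ℂ[X]} {c w : ℂ} {n : ℕ}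
    (hder : ∀ z, ‖z - c‖ ≤ 1 → n * (1 - ‖z - c‖) ^ (n - 1) ≤ ‖p.derivative.eval z‖) (hn : n ≠ 0)
    (hc : p.eval c = 0) (hw : ‖w‖ < 1) :
    ∃ z, ‖z - c‖ ≤ 1 ∧ p.eval z = w ∧ 1 - (1 - ‖z - c‖) ^ n ≤ ‖w‖ := by
  have hcomp : IsCompact (Metric.closedBall c 1 ∩ {z | p.eval z = w}) :=
    (isCompact_closedBall c 1).inter_right (isClosed_eq (by fun_prop) (by fun_prop))
  obtain ⟨K, hK, hK1⟩ := exists_between hw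
  obtain ⟨z, hz, hpz, -⟩ := exists_eval_eq_of_norm_lt hder hn hc hK hK1
  -- A minimiser on the compact fibre serves every `K > ‖w‖` at once, so `K` can decrease to `‖w‖`.
  obtain ⟨z₀, ⟨hz₀, hpz₀⟩, hmin⟩ := hcomp.exists_isMinOn ⟨z, mem_closedBall_iff_norm.2 hz, hpz⟩
    (f := fun z => 1 - (1 - ‖z - c‖) ^ n) (by fun_prop)
  refine ⟨z₀, mem_closedBall_iff_norm.1 hz₀, hpz₀, le_of_forall_gt_imp_ge_of_dense fun K hK => ?_⟩
  rcases lt_or_ge K 1 with hK1 | hK1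
  · obtain ⟨z, hz, hpz, hzK⟩ := exists_eval_eq_of_norm_lt hder hn hc hK hK1
    exact (hmin ⟨mem_closedBall_iff_norm.2 hz, hpz⟩).trans hzK
  · have := pow_nonneg (sub_nonneg.2 (mem_closedBall_iff_norm.1 hz₀)) n
    linarith

/-! ### Gauss–Lucas and the conclusion -/

theorem norm_le_one_of_isRoot_derivative {p : ℂ[X]} (hp : 0 < p.degree)
    (h : ∀ z, p.IsRoot z → ‖z‖ ≤ 1) (hp' : p.derivative ≠ 0) {ζ : ℂ} (hζ : p.derivative.IsRoot ζ) :
    ‖ζ‖ ≤ 1 := by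
  have h1 := rootSet_derivative_subset_convexHull_rootSet hp
    ((mem_rootSet_of_ne hp').2 (by simpa using hζ))
  have h2 : p.rootSet ℂ ⊆ Metric.closedBall 0 1 := fun z hz => by
    simpa using h z (by simpa using (mem_rootSet.1 hz).2)
  simpa using convexHull_min h2 (convex_closedBall 0 1) h1

theorem mainTheorem1 (n : ℕ) (hn : 1 ≤ n) (a : ℝ) (ha0 : 0 < a) (ha1 : a < 1)
    (z : Fin (n - 1) → ℂ) (hz : ∀ k, ‖z k‖ ≤ 1)
    (p : ℂ[X]) (hp : p = (X - C (a : ℂ)) * ∏ k, (X - C (z k)))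
    (hρ : ∀ ζ : ℂ, p.derivative.IsRoot ζ → 1 ≤ ‖(a : ℂ) - ζ‖)
    (lam : ℝ)
    (hlam_lower : 1 - (1 - ‖p.eval 0‖) ^ ((1 : ℝ) / (n : ℝ)) ≤ lam)
    (hlam_upper : lam ≤ Real.sin (Real.pi / (n : ℝ)))
    (hlam_a : lam < a) :
    ∃ ζ₀ : ℂ, p.derivative.IsRoot ζ₀ ∧
      (1 / 2 : ℝ) * (a - lam * (lam + 2) / a) ≤ ζ₀.re := by
  have hn0 : n ≠ 0 := by omega
  have hmonic : p.Monic := hp ▸ (monic_X_sub_C _).mul (monic_prod_X_sub_C _ _)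
  have hdeg : p.natDegree = n := by
    rw [hp, (monic_X_sub_C _).natDegree_mul (monic_prod_X_sub_C _ _), natDegree_X_sub_C,
      natDegree_finsetProd_X_sub_C_eq_card]
    simp
    omega
  have hdeg' : p.derivative.natDegree = n - 1 := by rw [natDegree_derivative, hdeg]
  have hlead : p.derivative.leadingCoeff = n := by
    rw [leadingCoeff, hdeg', coeff_derivative, Nat.sub_add_cancel hn, ← hdeg,
      hmonic.coeff_natDegree, hdeg]
    push_cast [hn]
    ring
  have hp' : p.derivative ≠ 0 := by
    rw [← leadingCoeff_ne_zero, hlead]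
    exact_mod_cast hn0
  have hpa : p.eval (a : ℂ) = 0 := by simp [hp]
  have hp0 : ‖p.eval 0‖ < 1 := by
    have : ∏ k, ‖z k‖ ≤ 1 := Finset.prod_le_one (fun _ _ => norm_nonneg _) fun k _ => hz k
    simp only [hp, eval_mul, eval_sub, eval_X, eval_C, eval_prod, zero_sub, norm_mul, norm_neg,
      norm_prod, Complex.norm_real, Real.norm_of_nonneg ha0.le]
    nlinarith
  have hder : ∀ x : ℂ, ‖x - a‖ ≤ 1 → n * (1 - ‖x - a‖) ^ (n - 1) ≤ ‖p.derivative.eval x‖ := by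
    intro x hx
    have h := leadingCoeff_mul_pow_le_norm_eval p.derivative hρ hx
    rwa [hlead, hdeg', Complex.norm_natCast] at h
  obtain ⟨w, hw1, hpw, hw⟩ := exists_eval_eq_of_norm_lt_one hder hn0 hpa hp0
  have hwlam : ‖w - a‖ ≤ lam := by
    have h1 : (1 - ‖p.eval 0‖) ^ ((1 : ℝ) / n) ≤ 1 - ‖w - a‖ := by
      rw [one_div, Real.rpow_inv_le_iff_of_pos (by linarith) (by linarith) (by positivity),
        Real.rpow_natCast]
      linarith
    linarith
  have hw0 : w ≠ 0 := by
    rintro rfl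
    rw [zero_sub, norm_neg, Complex.norm_real, Real.norm_of_nonneg ha0.le] at hwlam
    linarith
  obtain ⟨ζ, hζ, hζw⟩ := exists_isRoot_derivative_norm_sub_le hp' hw0 hpw
  refine ⟨ζ, hζ, ?_⟩
  have hζ1 : ‖ζ‖ ≤ 1 := by
    refine norm_le_one_of_isRoot_derivative ?_ (fun x hx => ?_) hp' hζ
    · rw [← natDegree_pos_iff_degree_pos, hdeg]; omega
    · rw [IsRoot, hp, eval_mul, eval_prod, mul_eq_zero, Finset.prod_eq_zero_iff] at hx
      rcases hx with hx | ⟨k, -, hx⟩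
      · rw [eval_sub, eval_X, eval_C, sub_eq_zero] at hx
        rw [hx, Complex.norm_real, Real.norm_of_nonneg ha0.le]
        exact ha1.le
      · rw [eval_sub, eval_X, eval_C, sub_eq_zero] at hx
        exact hx ▸ hz k
  have hlam0 : 0 ≤ lam := (norm_nonneg _).trans hwlam
  have h1 : ‖ζ - a‖ ≤ ‖ζ‖ + lam := by
    have := norm_add_le (ζ - w) (w - a)
    rw [sub_add_sub_cancel] at this
    linarith
  have h2 : ‖ζ - a‖ ^ 2 ≤ ‖ζ‖ ^ 2 + 2 * lam + lam ^ 2 := by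
    nlinarith [norm_nonneg (ζ - a), norm_nonneg ζ]
  simp only [Complex.sq_norm, Complex.normSq_apply, Complex.sub_re, Complex.sub_im,
    Complex.ofReal_re, Complex.ofReal_im] at h2
  have h3 : (1 / 2 : ℝ) * (a - lam * (lam + 2) / a) = (a ^ 2 - lam * (lam + 2)) / (2 * a) := by
    field_simp
  rw [h3, div_le_iff₀ (by positivity)]
  nlinarith
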